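/- **Setting.** Languages are subsets of $\{0,1\}^*$. For $i\ge 0$, $\Sigma^0_i$ and $\Pi^0_i$ denote the collections of languages at the $i$-th level of the arithmetical hierarchy ($\Sigma^0_1$ is the class of recursively enumerable languages, and $\Pi^0_i$ is the class of complements of $\Sigma^0_i$ languages). *The game.* Given languages $L_{=}$ and $L_{\neq}$, let $\Delta_0$ be the empty word and, for $n\ge 1$, let $\delta_n=1$ if $\Delta_{n-1}\in L_{=}\triangle L_{\neq}$, $\delta_n=0$ otherwise, and $\Delta_n=\Delta_{n-1}\delta_n$. The payoff of Player "$\neq$" is $$S(L_{=},L_{\neq})=\liminf_{N\to\infty}\sum_{n=1}^N\frac{\delta_n}{2N}+\limsup_{N\to\infty}\sum_{n=1}^N\frac{\delta_n}{2N}\in[0,1].$$ For collections $\Sigma_{=},\Sigma_{\neq}$ of languages let $$\mathrm{minmax}(\Sigma_{=},\Sigma_{\neq})=\inf_{D_{=}}\sup_{D_{\neq}}E\big(S(L_{=},L_{\neq})\big),$$ where $D_{=}$ and $D_{\neq}$ range over all (possibly incomputable) probability distributions on $\Sigma_{=}$ and $\Sigma_{\neq}$ respectively, and $L_{=}\sim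 D_{=}$, $L_{\neq}\sim D_{\neq}$ are independent. *Learnability.* Let $w_0,w_1,w_2,\dots$ be a computable enumeration of $\{0,1\}^*$ (every word occurs, repetitions allowed). For a language $L$ let $\mathit{NA}(L)=\{x\in\{0,1\}^*: w_{|x|}\in L\}$, where $|x|$ is the length of $x$, and for a collection $\Sigma$ let $\mathit{NA}(\Sigma)=\{\mathit{NA}(L):L\in\Sigma\}$. The collection $\Sigma_{\neq}$ is *learnable* by $\Sigma_{=}$ if $\mathrm{minmax}(\Sigma_{=},\mathit{NA}(\Sigma_{\neq}))=0$. **Corollary.** For every computable enumeration $w_0,w_1,\dots$ of $\{0,1\}^*$ and every $i>0$, $\Pi^0_i$ is learnable by $\Sigma^0_i$; that is, $$\mathrm{minmax}\big(\Sigma^0_i,\mathit{NA}(\Pi^0_i)\big)=0 .$$ -/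

import Mathlib

open MeasureTheory Filter
open scoped ENNReal symmDiff

namespace IMP

/-! ### The arithmetical hierarchy -/

/-- `IsSigma i p`: the predicate `p` is `Σ⁰ᵢ`. At level `0` these are the decidable predicates; `p` is
`Σ⁰ᵢ₊₁` if `p x ↔ ∃ y, q (x, y)` for some `q` that is `Π⁰ᵢ`, that is, whose negation is `Σ⁰ᵢ`. -/
def IsSigma : ℕ → ∀ {α : Type} [Primcodable α], (α → Prop) → Prop
  | 0, _, _, p => ComputablePred p
  | i + 1, α, _, p =>
      ∃ q : α × ℕ → Prop, IsSigma i (fun z => ¬ q z) ∧ ∀ x, p x ↔ ∃ y : ℕ, q (x, y)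

/-- The collection `Σ⁰ᵢ` of languages over the binary alphabet. -/
def SigmaLang (i : ℕ) : Set (Set (List Bool)) := {L | IsSigma i (fun u : List Bool => u ∈ L)}

/-- The collection `Π⁰ᵢ` (co-`Σ⁰ᵢ`) of languages over the binary alphabet. -/
def PiLang (i : ℕ) : Set (Set (List Bool)) := {L | Lᶜ ∈ SigmaLang i}

/-! ### The iterative matching pennies game -/

open Classical in
/-- The word `Δₙ = δ₁ ⋯ δₙ` of the results of the first `n` rounds, when Player "=" plays `A` and
Player "≠" plays `B`. -/
noncomputable def history (A B : Set (List Bool)) : ℕ → List Bool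
  | 0 => []
  | n + 1 => history A B n ++ [decide (history A B n ∈ A ∆ B)]

open Classical in
/-- `delta A B n` is `δₙ₊₁`, the result of the round that is played on the history `Δₙ`. -/
noncomputable def delta (A B : Set (List Bool)) (n : ℕ) : ℝ≥0∞ :=
  if history A B n ∈ A ∆ B then 1 else 0

/-- The payoff `S = S_≠` of Player "≠". It lies in `[0, 1]`; it is given as an element of `[0, ∞]`, a
complete lattice, so that limits inferior and superior, expectations, suprema and infima
are all genuine. -/
noncomputable def payoff (A B : Set (List Bool)) : ℝ≥0∞ :=
  liminf (fun N : ℕ => (∑ n ∈ Finset.range N, delta A B n) / (2 * (N : ℝ≥0∞))) atTop +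
    limsup (fun N : ℕ => (∑ n ∈ Finset.range N, delta A B n) / (2 * (N : ℝ≥0∞))) atTop

/-- The expected payoff of Player "≠" when the two players independently draw their languages
from the distributions `D` (Player "=") and `E` (Player "≠"). A collection of languages carries
the `σ`-algebra generated by the events `u ∈ L`, for words `u`. -/
noncomputable def expectedPayoff {SEq SNe : Set (Set (List Bool))}
    (D : ProbabilityMeasure SEq) (E : ProbabilityMeasure SNe) : ℝ≥0∞ :=
  ∫⁻ A, ∫⁻ B, payoff (A : Set (List Bool)) (B : Set (List Bool))
    ∂(E : Measure SNe) ∂(D : Measure SEq)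

/-- `minmax(Σ₌, Σ_≠)`, over all mixed strategies of the two players. -/
noncomputable def minmax (SEq SNe : Set (Set (List Bool))) : ℝ≥0∞ :=
  ⨅ D : ProbabilityMeasure SEq, ⨆ E : ProbabilityMeasure SNe, expectedPayoff D E

/-! ### Conventional learnability -/

/-- The nonadaptive language `NA(L)`, with respect to the enumeration `w` of all words. -/
def NA (w : ℕ → List Bool) (L : Set (List Bool)) : Set (List Bool) := {x | w x.length ∈ L}

/-- The collection `SNe` is (conventionally) learnable by the collection of strategies `SEq`. -/
def LearnableBy (w : ℕ → List Bool) (SNe SEq : Set (Set (List Bool))) : Prop :=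
  minmax SEq (NA w '' SNe) = 0

/-! ### The payoff is measurable and at most one -/

theorem measurableSet_symmDiff (u : List Bool) :
    MeasurableSet {p : Set (List Bool) × Set (List Bool) | u ∈ p.1 ∆ p.2} := by
  have h1 : MeasurableSet {p : Set (List Bool) × Set (List Bool) | u ∈ p.1} :=
    measurable_fst (measurableSet_setOfPred.2 (measurable_set_mem u))
  have h2 : MeasurableSet {p : Set (List Bool) × Set (List Bool) | u ∈ p.2} :=
    measurable_snd (measurableSet_setOfPred.2 (measurable_set_mem u))
  have : {p : Set (List Bool) × Set (List Bool) | u ∈ p.1 ∆ p.2} =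
      {p | u ∈ p.1} ∆ {p | u ∈ p.2} := by
    ext p; simp [Set.mem_symmDiff]
  rw [this]
  exact h1.symmDiff h2

theorem measurableSet_history_mem (n : ℕ)
    (h : ∀ u, MeasurableSet {p : Set (List Bool) × Set (List Bool) | history p.1 p.2 n = u}) :
    MeasurableSet {p : Set (List Bool) × Set (List Bool) |
      history p.1 p.2 n ∈ p.1 ∆ p.2} := by
  have : {p : Set (List Bool) × Set (List Bool) | history p.1 p.2 n ∈ p.1 ∆ p.2} =
      ⋃ u, ({p | history p.1 p.2 n = u} ∩ {p | u ∈ p.1 ∆ p.2}) := by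
    ext p; simp
  rw [this]
  exact MeasurableSet.iUnion fun u => (h u).inter (measurableSet_symmDiff u)

theorem measurableSet_history (n : ℕ) : ∀ u : List Bool,
    MeasurableSet {p : Set (List Bool) × Set (List Bool) | history p.1 p.2 n = u} := by
  classical
  induction n with
  | zero => intro u; exact MeasurableSet.const ([] = u)
  | succ n ih =>
    intro u
    have hm := measurableSet_history_mem n ih
    have : {p : Set (List Bool) × Set (List Bool) | history p.1 p.2 (n + 1) = u} =
        ⋃ v, ({p | history p.1 p.2 n = v} ∩
          (({p | history p.1 p.2 n ∈ p.1 ∆ p.2} ∩ {_p | v ++ [true] = u}) ∪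
            ({p | history p.1 p.2 n ∈ p.1 ∆ p.2}ᶜ ∩ {_p | v ++ [false] = u}))) := by
      ext p
      by_cases hp : history p.1 p.2 n ∈ p.1 ∆ p.2 <;> simp [history, hp]
    rw [this]
    exact MeasurableSet.iUnion fun v => (ih v).inter
      ((hm.inter (MeasurableSet.const _)).union (hm.compl.inter (MeasurableSet.const _)))

theorem measurable_payoff :
    Measurable (fun p : Set (List Bool) × Set (List Bool) => payoff p.1 p.2) := by
  classical
  have hd : ∀ n, Measurable
      (fun p : Set (List Bool) × Set (List Bool) => delta p.1 p.2 n) := fun n =>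
    Measurable.ite (measurableSet_history_mem n (measurableSet_history n))
      measurable_const measurable_const
  have hs : ∀ N : ℕ, Measurable (fun p : Set (List Bool) × Set (List Bool) =>
      (∑ n ∈ Finset.range N, delta p.1 p.2 n) / (2 * (N : ℝ≥0∞))) := fun N =>
    (Finset.measurable_fun_sum _ fun n _ => hd n).div_const _
  exact (Measurable.liminf hs).add (Measurable.limsup hs)

theorem payoff_le_one (A B : Set (List Bool)) : payoff A B ≤ 1 := by
  have h : ∀ N : ℕ, (∑ n ∈ Finset.range N, delta A B n) / (2 * (N : ℝ≥0∞)) ≤ 2⁻¹ := by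
    intro N
    have h1 : ∑ n ∈ Finset.range N, delta A B n ≤ (N : ℝ≥0∞) := by
      calc ∑ n ∈ Finset.range N, delta A B n ≤ ∑ _n ∈ Finset.range N, (1 : ℝ≥0∞) :=
            Finset.sum_le_sum fun n _ => by unfold delta; split_ifs <;> simp
        _ = N := by simp
    refine ENNReal.div_le_of_le_mul (h1.trans (le_of_eq ?_))
    rw [← mul_assoc, ENNReal.inv_mul_cancel (by simp) (by simp), one_mul]
  have hsup : limsup (fun N : ℕ => (∑ n ∈ Finset.range N, delta A B n) / (2 * (N : ℝ≥0∞))) atTop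
      ≤ 2⁻¹ := limsup_le_of_le (h := Eventually.of_forall h)
  unfold payoff
  calc _ ≤ (2⁻¹ : ℝ≥0∞) + 2⁻¹ := add_le_add ((liminf_le_limsup).trans hsup) hsup
    _ = 1 := ENNReal.inv_two_add_inv_two

end IMP

/-! The opponent's choice on round `n` depends only on `n`. Let `U` be the set of rounds on which
the opponent plays 0; it is `Σ⁰ᵢ`, hence the increasing union of the stages of some index `k` of a
universal predicate. A `Σ⁰ᵢ` player can search for a stage `T` and play from it, but a stage that is
still too small must not trigger a wrong choice. The remedy is to certify stages by a census: a
stage lies inside `U`, so it equals `U` on an interval as soon as it has as many elements there as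
`U`.

The census is stored in the history. On reserved square rounds, which have density zero, thread `k`
plays the binary digits of the number of elements of `U` in a longer initial segment. The history
shows only mismatches, but where `U` is already known they reveal the digits, and the census of one
shell covers the question rounds of the next. Digits go out with the most significant first, so a
stage inside `U` that explains all earlier results cannot wrongly claim a digit 1
(`Consistent.answer_mono`). After the census, consistent stages predict the opponent
(`history_notMem_symmDiff`). The correct index is found by counting mismatches on nonsquare rounds:
each one passes the turn on, and the count stops for good at the latest when the correct thread is
reached late enough (`exists_errors_le`).

The first census has no earlier knowledge to rest on, and this is where randomness enters. One of
`R` initial shells, chosen by the seed `r`, carries the first count in unary; the others carry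
constant answers and so reveal `U` directly. Decoding fails only if some stage is correct on all
other initial shells and wrong on shell `r`. Since stages increase, this happens for at most one
seed (`unfooled_or_unfooled`). A uniform seed thus bounds the expected payoff by `1/R`, and `R` is
arbitrary. -/

namespace IMP

/-! ### Closure properties of the arithmetical hierarchy -/

section Closure

variable {α β : Type} [Primcodable α] [Primcodable β]

theorem isSigma_of_iff {i : ℕ} {p q : α → Prop} (hp : IsSigma i p) (h : ∀ a, p a ↔ q a) :
    IsSigma i q := by
  rwa [← funext fun a => propext (h a)]

theorem isSigma_comp {i : ℕ} {p : β → Prop} {f : α → β} (hf : Computable f)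
    (hp : IsSigma i p) : IsSigma i (fun a => p (f a)) := by
  induction i generalizing α β with
  | zero =>
    obtain ⟨_, h⟩ := hp
    exact ⟨fun a => inferInstanceAs (Decidable (p (f a))), h.comp hf⟩
  | succ i ih =>
    obtain ⟨q, hq, h⟩ := hp
    exact ⟨fun z => q (f z.1, z.2),
      ih (f := fun z : α × ℕ => (f z.1, z.2)) ((hf.comp .fst).pair .snd) hq, fun a => h (f a)⟩

theorem computablePred_and {p q : α → Prop} (hp : ComputablePred p) (hq : ComputablePred q) :
    ComputablePred (fun a => p a ∧ q a) := by
  obtain ⟨_, hp⟩ := hp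
  obtain ⟨_, hq⟩ := hq
  refine ⟨fun a => inferInstance, (Primrec.and.to_comp.comp hp hq).of_eq fun a => ?_⟩
  simp

theorem computablePred_or {p q : α → Prop} (hp : ComputablePred p) (hq : ComputablePred q) :
    ComputablePred (fun a => p a ∨ q a) :=
  (computablePred_and hp.not hq.not).not.of_eq fun a => by tauto

/-- The two claims need a joint induction, because the matrix enters the definition through its
negation, which exchanges `∧` and `∨`. -/
theorem isSigma_and_or {i : ℕ} {p q : α → Prop} (hp : IsSigma i p) (hq : IsSigma i q) :
    IsSigma i (fun a => p a ∧ q a) ∧ IsSigma i (fun a => p a ∨ q a) := by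
  induction i generalizing α with
  | zero => exact ⟨computablePred_and hp hq, computablePred_or hp hq⟩
  | succ i ih =>
    obtain ⟨p', hp', hp⟩ := hp
    obtain ⟨q', hq', hq⟩ := hq
    constructor
    · have h1 : Computable fun z : α × ℕ => (z.1, z.2.unpair.1) :=
        Computable.fst.pair (Computable.fst.comp (Primrec.unpair.to_comp.comp .snd))
      have h2 : Computable fun z : α × ℕ => (z.1, z.2.unpair.2) :=
        Computable.fst.pair (Computable.snd.comp (Primrec.unpair.to_comp.comp .snd))
      refine ⟨fun z => p' (z.1, z.2.unpair.1) ∧ q' (z.1, z.2.unpair.2),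
        isSigma_of_iff (ih (isSigma_comp h1 hp') (isSigma_comp h2 hq')).2 fun a => by tauto,
        fun a => ?_⟩
      simp only [hp, hq]
      constructor
      · rintro ⟨⟨y, hy⟩, z, hz⟩
        exact ⟨Nat.pair y z, by simpa using ⟨hy, hz⟩⟩
      · rintro ⟨y, hy⟩
        exact ⟨⟨_, hy.1⟩, _, hy.2⟩
    · refine ⟨fun z => p' z ∨ q' z,
        isSigma_of_iff (ih hp' hq').1 fun a => by tauto, fun a => ?_⟩
      simp only [hp, hq, exists_or]

theorem isSigma_and {i : ℕ} {p q : α → Prop} (hp : IsSigma i p) (hq : IsSigma i q) :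
    IsSigma i (fun a => p a ∧ q a) := (isSigma_and_or hp hq).1

theorem isSigma_or {i : ℕ} {p q : α → Prop} (hp : IsSigma i p) (hq : IsSigma i q) :
    IsSigma i (fun a => p a ∨ q a) := (isSigma_and_or hp hq).2

theorem isSigma_exists_nat {i : ℕ} {p : α × ℕ → Prop} (hp : IsSigma (i + 1) p) :
    IsSigma (i + 1) (fun a => ∃ y, p (a, y)) := by
  obtain ⟨q, hq, h⟩ := hp
  have h1 : Computable fun z : α × ℕ => ((z.1, z.2.unpair.1), z.2.unpair.2) :=
    (Computable.fst.pair (Computable.fst.comp (Primrec.unpair.to_comp.comp .snd))).pair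
      (Computable.snd.comp (Primrec.unpair.to_comp.comp .snd))
  refine ⟨fun z => q ((z.1, z.2.unpair.1), z.2.unpair.2),
    isSigma_comp (p := fun z => ¬ q z) h1 hq, fun a => ?_⟩
  simp only [h]
  constructor
  · rintro ⟨y, z, hz⟩
    exact ⟨Nat.pair y z, by simpa using hz⟩
  · rintro ⟨y, hy⟩
    exact ⟨_, _, hy⟩

theorem isSigma_succ_of_not {i : ℕ} {p : α → Prop} (hp : IsSigma i (fun a => ¬ p a)) :
    IsSigma (i + 1) p :=
  ⟨fun z => p z.1, isSigma_comp (f := fun z : α × ℕ => z.1) .fst hp, fun a => by simp⟩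

theorem isSigma_succ {i : ℕ} {p : α → Prop} (hp : IsSigma i p) : IsSigma (i + 1) p := by
  induction i generalizing α with
  | zero => exact isSigma_succ_of_not hp.not
  | succ i ih =>
    obtain ⟨q, hq, h⟩ := hp
    exact ⟨q, ih hq, h⟩

theorem isSigma_of_computablePred {i : ℕ} {p : α → Prop} (hp : ComputablePred p) :
    IsSigma i p := by
  induction i with
  | zero => exact hp
  | succ i ih => exact isSigma_succ ih

theorem isSigma_exists [Inhabited β] {i : ℕ} {p : α × β → Prop} (hp : IsSigma (i + 1) p) :
    IsSigma (i + 1) (fun a => ∃ b, p (a, b)) := by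
  have h1 : Computable fun z : α × ℕ => (z.1, (Encodable.decode (α := β) z.2).getD default) :=
    Computable.fst.pair (Computable.option_getD (Computable.decode.comp .snd) (.const _))
  refine isSigma_of_iff (isSigma_exists_nat (isSigma_comp h1 hp)) fun a => ?_
  constructor
  · rintro ⟨y, hy⟩
    exact ⟨_, hy⟩
  · rintro ⟨b, hb⟩
    exact ⟨Encodable.encode b, by simpa using hb⟩

theorem computablePred_forall_lt {p : α × ℕ → Prop} {f : α → ℕ} (hf : Computable f)
    (hp : ComputablePred p) : ComputablePred (fun a => ∀ m < f a, p (a, m)) := by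
  obtain ⟨g, hg, rfl⟩ := ComputablePred.computable_iff.1 hp
  refine ComputablePred.computable_iff.2
    ⟨fun a => Nat.rec true (fun m b => b && g (a, m)) (f a), ?_, ?_⟩
  · exact Computable.nat_rec (h := fun a (z : ℕ × Bool) => z.2 && g (a, z.1)) hf (.const true)
      (Primrec.and.to_comp.comp (Computable.snd.comp .snd)
        (hg.comp (Computable.fst.pair (Computable.fst.comp .snd))))
  · funext a
    have : ∀ n : ℕ, (∀ m < n, g (a, m) = true) =
        ((Nat.rec true (fun m b => b && g (a, m)) n : Bool) = true) := by
      intro n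
      induction n with
      | zero => simp
      | succ n ih => simp only [Nat.lt_succ_iff_lt_or_eq, or_imp, forall_and, forall_eq, ih,
          Bool.and_eq_true]
    exact this (f a)

/-- A list collects the witnesses for all `m < f a`, which moves the bounded quantifier inside the
existential one. There its negation is a bounded existential quantifier, absorbed by the unbounded
one of the matrix's negation. -/
theorem isSigma_forall_lt {i : ℕ} {p : α × ℕ → Prop} {f : α → ℕ} (hf : Computable f)
    (hp : IsSigma i p) : IsSigma i (fun a => ∀ m < f a, p (a, m)) := by
  induction i generalizing α with
  | zero => exact computablePred_forall_lt hf hp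
  | succ i ih =>
    obtain ⟨q, hq, h⟩ := hp
    have hex : IsSigma (i + 1) (fun a : α => ∀ m < f a, p (a, m)) ↔
        IsSigma (i + 1) (fun a : α => ∃ Y : List ℕ, ∀ m < f a, q ((a, m), Y.getD m 0)) := by
      refine Eq.to_iff (congrArg _ (funext fun a => propext ⟨fun H => ?_, ?_⟩))
      · simp only [h] at H
        choose! y hy using H
        exact ⟨(List.range (f a)).map y, fun m hm => by simpa [hm] using hy m hm⟩
      · rintro ⟨Y, hY⟩ m hm
        exact (h _).2 ⟨_, hY m hm⟩
    rw [hex]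
    refine isSigma_exists (p := fun z : α × List ℕ => ∀ m < f z.1, q ((z.1, m), z.2.getD m 0))
      (isSigma_succ_of_not ?_)
    have hc : Computable fun z : (α × List ℕ) × ℕ => ((z.1.1, z.2), z.1.2.getD z.2 0) :=
      ((Computable.fst.comp .fst).pair .snd).pair
        ((Primrec.list_getD 0).to_comp.comp (Computable.snd.comp .fst) .snd)
    have hq' := isSigma_comp hc hq
    cases i with
    -- At level 0 no unbounded quantifier is available for absorption, but bounded search is
    -- decidable.
    | zero =>
      exact (computablePred_forall_lt (hf.comp .fst)
        (hq'.not.of_eq fun z => not_not)).not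
    | succ i =>
      have hlt : ComputablePred fun z : (α × List ℕ) × ℕ => z.2 < f z.1.1 := by
        obtain ⟨_, h⟩ := (Primrec.nat_lt : PrimrecRel ((· < ·) : ℕ → ℕ → Prop))
        exact ⟨fun _ => inferInstance, ((h.to_comp.comp
          (Computable.snd.pair (hf.comp (Computable.fst.comp .fst)))).of_eq fun z => by simp)⟩
      refine isSigma_of_iff (isSigma_exists_nat
        (isSigma_and (isSigma_of_computablePred hlt) hq')) fun z => ?_
      push Not
      rfl

end Closure

/-! ### A universal predicate for each level -/

/-- The matrix of a universal `Σ⁰ᵢ₊₁` predicate on the natural numbers. -/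
def univMatrix : ℕ → ℕ × ℕ × ℕ → Prop
  | 0, z => (Nat.Partrec.Code.evaln z.2.2 (Denumerable.ofNat Nat.Partrec.Code z.1) z.2.1).isSome
  | i + 1, z => ¬ ∃ y, univMatrix i (z.1, Nat.pair z.2.1 z.2.2, y)

theorem isSigma_not_univMatrix (i : ℕ) : IsSigma i (fun z => ¬ univMatrix i z) := by
  induction i with
  | zero =>
    refine ComputablePred.not (p := univMatrix 0) ?_
    refine ⟨fun z => inferInstanceAs (Decidable (_ = true)), ?_⟩
    refine Computable.of_eq (f := fun z : ℕ × ℕ × ℕ => (Nat.Partrec.Code.evaln z.2.2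
      (Denumerable.ofNat Nat.Partrec.Code z.1) z.2.1).isSome) ?_ fun z => (Bool.decide_coe _).symm
    exact (Primrec.option_isSome.comp (Nat.Partrec.Code.primrec_evaln.comp
      (((Primrec.snd.comp .snd).pair ((Primrec.ofNat _).comp .fst)).pair
        (Primrec.fst.comp .snd)))).to_comp
  | succ i ih =>
    have hp : Primrec fun z : (ℕ × ℕ × ℕ) × ℕ => Nat.pair z.1.2.1 z.1.2.2 :=
      Primrec₂.natPair.comp (.comp .fst (.comp .snd .fst)) (.comp .snd (.comp .snd .fst))
    have h1 : Primrec fun z : (ℕ × ℕ × ℕ) × ℕ => z.1.1 := .comp .fst .fst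
    have h2 := isSigma_comp (p := fun z => ¬ univMatrix i z)
      (f := fun z : (ℕ × ℕ × ℕ) × ℕ => (z.1.1, Nat.pair z.1.2.1 z.1.2.2, z.2))
      (h1.pair (hp.pair .snd)).to_comp ih
    have h3 : IsSigma (i + 1) fun z : (ℕ × ℕ × ℕ) × ℕ =>
        univMatrix i (z.1.1, Nat.pair z.1.2.1 z.1.2.2, z.2) := isSigma_succ_of_not h2
    have h4 : IsSigma (i + 1) fun z : ℕ × ℕ × ℕ =>
        ∃ y, univMatrix i (z.1, Nat.pair z.2.1 z.2.2, y) := isSigma_exists_nat h3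
    exact isSigma_of_iff h4 fun z => not_not.symm

/-- At level one, `p` is the domain of an unbounded search, hence of a code. Higher up, the outer
witness is packed into the argument and the index of the negated matrix is reused. -/
theorem exists_univMatrix_index {i : ℕ} {p : ℕ → Prop} (hp : IsSigma (i + 1) p) :
    ∃ k, ∀ n, p n ↔ ∃ y, univMatrix i (k, n, y) := by
  induction i generalizing p with
  | zero =>
    obtain ⟨q, hq, h⟩ := hp
    obtain ⟨g, hg, hgq⟩ := ComputablePred.computable_iff.1 hq.not
    have hgq' : ∀ z, q z ↔ g z = true := fun z => by
      have := congrFun hgq z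
      simpa using this
    have hf : Partrec fun n : ℕ => Nat.rfind fun y => (g (n, y) : Bool) :=
      Partrec.rfind hg.partrec
    obtain ⟨c, hc⟩ := Nat.Partrec.Code.exists_code.1 (Partrec.nat_iff.1 hf)
    refine ⟨Encodable.encode c, fun n => ?_⟩
    have h1 : p n ↔ (Nat.Partrec.Code.eval c n).Dom := by
      rw [hc, h]
      refine Iff.trans ?_ Nat.rfind_dom.symm
      simp only [hgq', Part.coe_some, Part.mem_some_iff, Part.some_dom, implies_true, and_true]
      exact exists_congr fun y => eq_comm
    rw [h1, Part.dom_iff_mem]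
    simp only [univMatrix, Denumerable.ofNat_encode, Option.isSome_iff_exists,
      Nat.Partrec.Code.evaln_complete]
    exact exists_comm
  | succ i ih =>
    obtain ⟨q, hq, h⟩ := hp
    obtain ⟨k, hk⟩ := ih (isSigma_comp (f := Nat.unpair) Primrec.unpair.to_comp hq)
    refine ⟨k, fun n => ?_⟩
    rw [h]
    refine exists_congr fun y => ?_
    have := hk (Nat.pair n y)
    rw [Nat.unpair_pair] at this
    rw [univMatrix, ← this, not_not]

/-! ### Counting along a list -/

/-- The number of entries of `l` that satisfy `T`. -/
def count (T : ℕ → Bool) (l : List ℕ) : ℕ := (l.filter T).length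

theorem count_le_length (T : ℕ → Bool) (l : List ℕ) : count T l ≤ l.length :=
  List.length_filter_le _ _

theorem count_congr {T U : ℕ → Bool} {l : List ℕ} (h : ∀ m ∈ l, T m = U m) :
    count T l = count U l := by
  rw [count, count, List.filter_congr h]

theorem count_mono {T U : ℕ → Bool} (h : ∀ m, T m = true → U m = true) (l : List ℕ) :
    count T l ≤ count U l :=
  (List.monotone_filter_right l h).length_le

/-- The census principle: one number certifies a whole subset. -/
theorem eq_of_count_eq {T U : ℕ → Bool} (h : ∀ m, T m = true → U m = true) {l : List ℕ}
    (hc : count T l = count U l) : ∀ m ∈ l, T m = U m := by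
  have := (List.monotone_filter_right l h).eq_of_length hc
  intro m hm
  have h1 : m ∈ l.filter T ↔ m ∈ l.filter U := by rw [this]
  rw [List.mem_filter, List.mem_filter] at h1
  exact Bool.eq_iff_iff.2 ⟨fun ht => (h1.1 ⟨hm, ht⟩).2, fun hu => (h1.2 ⟨hm, hu⟩).2⟩

/-! ### Timetable -/

/-- The fourth power. -/
def pow4 (m : ℕ) : ℕ := m * m * (m * m)

theorem pow4_strictMono : StrictMono pow4 := fun a b h => by
  have h1 : a * a < b * b := Nat.mul_self_lt_mul_self h
  exact Nat.mul_self_lt_mul_self h1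

theorem le_pow4 (m : ℕ) : m ≤ pow4 m := (Nat.le_mul_self m).trans (Nat.le_mul_self _)

/-- The integer fourth root. -/
def shell (n : ℕ) : ℕ := Nat.sqrt (Nat.sqrt n)

theorem shell_lt {n m : ℕ} : shell n < m ↔ n < pow4 m := by
  rw [shell, Nat.sqrt_lt, Nat.sqrt_lt, pow4]

theorem le_shell {n m : ℕ} : m ≤ shell n ↔ pow4 m ≤ n := by
  rw [← not_lt, shell_lt, not_lt]

theorem shell_le (n : ℕ) : shell n ≤ n := (Nat.sqrt_le_self _).trans (Nat.sqrt_le_self _)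

/-- The thread that may ask a question on the square round `n`, and the index of the question. -/
def slot (n : ℕ) : ℕ × ℕ := Nat.unpair (Nat.sqrt n - shell n * shell n)

/-- The round on which thread `k` asks its question number `l` of shell `j`. -/
def questionRound (j k l : ℕ) : ℕ := (j * j + Nat.pair k l) * (j * j + Nat.pair k l)

theorem pair_lt_of_lt_sqrt {j k l : ℕ} (hk : k < Nat.sqrt j) (hl : l < Nat.sqrt j) :
    Nat.pair k l < j := by
  calc Nat.pair k l < (max k l + 1) ^ 2 := Nat.pair_lt_max_add_one_sq k l
    _ ≤ Nat.sqrt j ^ 2 := Nat.pow_le_pow_left (by omega) 2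
    _ ≤ j := Nat.sqrt_le' j

theorem sqrt_questionRound (j k l : ℕ) :
    Nat.sqrt (questionRound j k l) = j * j + Nat.pair k l := Nat.sqrt_eq _

theorem shell_questionRound {j k l : ℕ} (hk : k < Nat.sqrt j) (hl : l < Nat.sqrt j) :
    shell (questionRound j k l) = j := by
  rw [shell, sqrt_questionRound]
  exact Nat.sqrt_add_eq _ ((pair_lt_of_lt_sqrt hk hl).le.trans (by omega))

theorem slot_questionRound {j k l : ℕ} (hk : k < Nat.sqrt j) (hl : l < Nat.sqrt j) :
    slot (questionRound j k l) = (k, l) := by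
  rw [slot, shell_questionRound hk hl, sqrt_questionRound, Nat.add_sub_cancel_left,
    Nat.unpair_pair]

theorem questionRound_lt_questionRound {j k l l' : ℕ} (h : l < l') :
    questionRound j k l < questionRound j k l' :=
  Nat.mul_self_lt_mul_self (Nat.add_lt_add_left (Nat.pair_lt_pair_right k h) _)

/-- The square root of the shell from which on thread `k` is active. -/
def offset (R k : ℕ) : ℕ := k + R + 64

/-- The shell from which on thread `k` asks its regular questions. The `R` shells before it are the
initial shells of the thread. -/
def startShell (R k : ℕ) : ℕ := offset R k * offset R k + R

/-- Round `n` is reserved for a question of thread `k`. -/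
def Active (R k n : ℕ) : Prop :=
  Nat.sqrt n * Nat.sqrt n = n ∧ (slot n).1 = k ∧ (slot n).2 < Nat.sqrt (shell n) ∧
    offset R k * offset R k ≤ shell n

instance (R k n : ℕ) : Decidable (Active R k n) := inferInstanceAs (Decidable (_ ∧ _))

/-- The rounds of thread `k` in its first regular shell. -/
def startRounds (R k : ℕ) : List ℕ :=
  (List.range (offset R k)).map (questionRound (startShell R k) k)

/-- The answer that thread `k` announces on round `n` if `T` is the complement of the language of
the opponent and `r` is the seed. -/
def answer (R r : ℕ) (T : ℕ → Bool) (k n : ℕ) : Bool :=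
  if Active R k n then
    if shell n < startShell R k then
      -- The unary code is monotone in `T` without any further knowledge, so it is sound before the
      -- initial shells have been decoded.
      if shell n = offset R k * offset R k + r then
        decide ((slot n).2 < count T (startRounds R k))
      else false
    -- Question 0 asks for the most significant digit. The range covers the current shell and the
    -- next one.
    else (count T (List.range (pow4 (shell n + 2)))).testBit (Nat.sqrt (shell n) - 1 - (slot n).2)
  else !T n

/-- All initial shells and the start shell thus have `offset R k` slots for thread `k`, just enough
for a unary count of `startRounds`. -/
theorem sqrt_offset {R k d : ℕ} (hd : d ≤ R) :
    Nat.sqrt (offset R k * offset R k + d) = offset R k :=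
  Nat.sqrt_add_eq _ (by unfold offset; omega)

theorem lt_sqrt_of_le {R k j : ℕ} (hj : offset R k * offset R k ≤ j) : k < Nat.sqrt j :=
  lt_of_lt_of_le (by unfold offset; omega) (Nat.le_sqrt.2 hj)

theorem active_questionRound {R k j l : ℕ} (hj : offset R k * offset R k ≤ j)
    (hl : l < Nat.sqrt j) : Active R k (questionRound j k l) := by
  have hk := lt_sqrt_of_le hj
  refine ⟨?_, ?_, ?_, ?_⟩
  · rw [sqrt_questionRound]; rfl
  · rw [slot_questionRound hk hl]
  · rwa [slot_questionRound hk hl, shell_questionRound hk hl]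
  · rwa [shell_questionRound hk hl]

theorem Active.eq_questionRound {R k n : ℕ} (h : Active R k n) :
    n = questionRound (shell n) k (slot n).2 := by
  obtain ⟨h1, h2, -, -⟩ := h
  have h3 : shell n * shell n ≤ Nat.sqrt n := Nat.sqrt_le _
  rw [questionRound, ← h2, slot, Nat.pair_unpair, Nat.add_sub_cancel' h3, h1]

theorem questionRound_lt_pow4 {j k l m : ℕ} (hk : k < Nat.sqrt j) (hl : l < Nat.sqrt j)
    (hm : j < m) : questionRound j k l < pow4 m := by
  rwa [← shell_lt, shell_questionRound hk hl]

/-- With `c = √j` this makes `√j` binary digits suffice for a census below `(j + 2)⁴`; it is the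
reason for the 64 in `offset`. -/
theorem add_two_pow_eight_lt {c : ℕ} (hc : 64 ≤ c) : (c + 2) ^ 8 < 2 ^ c := by
  induction c, hc using Nat.le_induction with
  | base => norm_num
  | succ c hc ih =>
    -- The left side grows by a factor of at most `(67/66)⁸ < 2`.
    have h1 : 66 * (c + 1 + 2) ≤ 67 * (c + 2) := by omega
    have h2 := Nat.pow_le_pow_left h1 8
    rw [mul_pow, mul_pow] at h2
    rw [pow_succ 2 c]
    norm_num at h2 ⊢
    omega

theorem pow4_lt_two_pow {R k j : ℕ} (hj : offset R k * offset R k ≤ j) :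
    pow4 (j + 2) < 2 ^ Nat.sqrt j := by
  have h0 : offset R k ≤ Nat.sqrt j := Nat.le_sqrt.2 hj
  have hc : 64 ≤ Nat.sqrt j := le_trans (by unfold offset; omega) h0
  have h1 : j + 2 ≤ (Nat.sqrt j + 2) * (Nat.sqrt j + 2) := by
    have := Nat.sqrt_le_add j
    nlinarith
  calc pow4 (j + 2) ≤ pow4 ((Nat.sqrt j + 2) * (Nat.sqrt j + 2)) :=
        pow4_strictMono.monotone h1
    _ = (Nat.sqrt j + 2) ^ 8 := by unfold pow4; ring
    _ < _ := add_two_pow_eight_lt hc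

theorem count_range_lt {R k j : ℕ} (hj : offset R k * offset R k ≤ j) (T : ℕ → Bool) :
    count T (List.range (pow4 (j + 2))) < 2 ^ Nat.sqrt j := by
  refine lt_of_le_of_lt (count_le_length _ _) ?_
  rw [List.length_range]
  exact pow4_lt_two_pow hj

theorem answer_initial {R r k n : ℕ} {T : ℕ → Bool} (h : Active R k n)
    (hn : shell n < startShell R k) (hr : shell n = offset R k * offset R k + r) :
    answer R r T k n = decide ((slot n).2 < count T (startRounds R k)) := by
  rw [answer, if_pos h, if_pos hn, if_pos hr]

theorem answer_initial_of_ne {R r k n : ℕ} {T : ℕ → Bool} (h : Active R k n)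
    (hn : shell n < startShell R k) (hr : shell n ≠ offset R k * offset R k + r) :
    answer R r T k n = false := by
  rw [answer, if_pos h, if_pos hn, if_neg hr]

theorem answer_regular {R r k n : ℕ} {T : ℕ → Bool} (h : Active R k n)
    (hn : startShell R k ≤ shell n) :
    answer R r T k n = (count T (List.range (pow4 (shell n + 2)))).testBit
      (Nat.sqrt (shell n) - 1 - (slot n).2) := by
  rw [answer, if_pos h, if_neg hn.not_gt]

/-- A bound for the arguments on which the answer on round `n` depends. -/
def horizon (R n : ℕ) : ℕ := pow4 (n + R + 2)

theorem horizon_mono (R : ℕ) : Monotone (horizon R) := fun a b h =>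
  pow4_strictMono.monotone (by omega)

theorem lt_horizon (R n : ℕ) : n < horizon R n := lt_of_lt_of_le (by omega) (le_pow4 (n + R + 2))

theorem answer_congr {R r k n : ℕ} {T U : ℕ → Bool} (h : ∀ m < horizon R n, T m = U m) :
    answer R r T k n = answer R r U k n := by
  by_cases hA : Active R k n
  · have hsn := shell_le n
    have h1 : count T (List.range (pow4 (shell n + 2))) =
        count U (List.range (pow4 (shell n + 2))) :=
      count_congr fun m hm => h m ((List.mem_range.1 hm).trans_le
        (pow4_strictMono.monotone (by omega)))
    have h2 : count T (startRounds R k) = count U (startRounds R k) := by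
      refine count_congr fun m hm => h m ?_
      obtain ⟨l, hl, rfl⟩ := List.mem_map.1 hm
      rw [List.mem_range] at hl
      have hJ : offset R k * offset R k ≤ startShell R k := Nat.le_add_right _ _
      refine questionRound_lt_pow4 (lt_sqrt_of_le hJ) ?_ ?_
      · rw [startShell, sqrt_offset le_rfl]; exact hl
      -- The start shell may lie up to `R` shells ahead of an active round; hence the `R` in
      -- `horizon`.
      · have := hA.2.2.2
        unfold startShell
        omega
    rw [answer, answer, h1, h2, h n (lt_horizon R n)]
  · rw [answer, answer, if_neg hA, if_neg hA, h n (lt_horizon R n)]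

/-! ### Histories that are consistent with a stage -/

/-- The result of round `n` if the complement of the opponent's language is `T` and the answer of
thread `k` is played. -/
def result (R r : ℕ) (T : ℕ → Bool) (k n : ℕ) : Bool := xor (!T n) (answer R r T k n)

/-- The stages `T` and `U` explain the same results on the rounds of thread `k` before `n`. -/
def Consistent (R r : ℕ) (T U : ℕ → Bool) (k n : ℕ) : Prop :=
  ∀ q < n, Active R k q → result R r T k q = result R r U k q

/-- If `T` agrees with `U` on the initial shells of thread `k` other than shell number `r`, then
they agree on that shell, too. -/
def Unfooled (R r : ℕ) (T U : ℕ → Bool) (k : ℕ) : Prop :=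
  (∀ q, Active R k q → shell q < startShell R k → shell q ≠ offset R k * offset R k + r →
    T q = U q) → ∀ q, Active R k q → shell q = offset R k * offset R k + r → T q = U q

/-! ### Decoding the history: soundness of consistent stages -/

section Consistent

variable {R r k n : ℕ} {T U : ℕ → Bool}

theorem Consistent.answer_eq (h : Consistent R r T U k n) {q : ℕ} (hq : q < n)
    (hA : Active R k q) (hTU : T q = U q) : answer R r T k q = answer R r U k q := by
  have := h q hq hA
  rw [result, result, hTU] at this
  exact Bool.xor_right_inj.1 this

theorem Consistent.eq_of_answer_eq (h : Consistent R r T U k n) {q : ℕ} (hq : q < n)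
    (hA : Active R k q) (ha : answer R r T k q = answer R r U k q) : T q = U q := by
  have := h q hq hA
  rw [result, result, ha] at this
  exact Bool.not_inj (Bool.xor_left_inj.1 this)

/-- Constant answers make the results reveal `U` on the other initial shells; `Unfooled` extends
this to shell `r`, where the unary answers then reveal the first count. -/
theorem Consistent.eq_on_startRounds (hr : r < R) (hTU : ∀ m, T m = true → U m = true)
    (hun : Unfooled R r T U k) (h : Consistent R r T U k n) (hn : pow4 (startShell R k) ≤ n) :
    ∀ q, Active R k q → shell q = startShell R k → T q = U q := by
  have hlt : ∀ {q}, shell q < startShell R k → q < n := fun hq => (shell_lt.1 hq).trans_le hn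
  have h1 : ∀ q, Active R k q → shell q = offset R k * offset R k + r → T q = U q :=
    hun fun q hA hq hqr => h.eq_of_answer_eq (hlt hq) hA (by
      rw [answer_initial_of_ne hA hq hqr, answer_initial_of_ne hA hq hqr])
  have hlen : (startRounds R k).length = offset R k := by simp [startRounds]
  have h2 : ∀ l < offset R k,
      (l < count T (startRounds R k) ↔ l < count U (startRounds R k)) := by
    intro l hl
    have hj : offset R k * offset R k ≤ offset R k * offset R k + r := Nat.le_add_right _ _
    have hk := lt_sqrt_of_le hj
    have hl' : l < Nat.sqrt (offset R k * offset R k + r) := by rwa [sqrt_offset hr.le]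
    have hA := active_questionRound hj hl'
    have hs := shell_questionRound hk hl'
    have hs' : shell (questionRound (offset R k * offset R k + r) k l) < startShell R k := by
      rw [hs, startShell]; omega
    have := h.answer_eq (hlt hs') hA (h1 _ hA hs)
    rw [answer_initial hA hs' hs, answer_initial hA hs' hs, slot_questionRound hk hl'] at this
    simpa using this
  have h3 : count T (startRounds R k) = count U (startRounds R k) := by
    have hT := count_le_length T (startRounds R k)
    have hU := count_le_length U (startRounds R k)
    rw [hlen] at hT hU
    by_contra hne
    rcases lt_or_gt_of_ne hne with hlt' | hlt'
    · exact lt_irrefl _ ((h2 _ (hlt'.trans_le hU)).2 hlt')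
    · exact lt_irrefl _ ((h2 _ (hlt'.trans_le hT)).1 hlt')
  intro q hA hq
  refine eq_of_count_eq hTU h3 q (List.mem_map.2 ⟨(slot q).2, List.mem_range.2 ?_, ?_⟩)
  · have := hA.2.2.1
    rwa [hq, startShell, sqrt_offset le_rfl] at this
  · rw [← hq]
    exact hA.eq_questionRound.symm

theorem Consistent.testBit_eq {j l : ℕ} (hj : startShell R k ≤ j) (hl : l < Nat.sqrt j)
    (hn : questionRound j k l < n) (h : Consistent R r T U k n)
    (hq : ∀ q, Active R k q → shell q = j → T q = U q) :
    (count T (List.range (pow4 (j + 2)))).testBit (Nat.sqrt j - 1 - l) =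
      (count U (List.range (pow4 (j + 2)))).testBit (Nat.sqrt j - 1 - l) := by
  have hj' : offset R k * offset R k ≤ j := (Nat.le_add_right _ _).trans hj
  have hk := lt_sqrt_of_le hj'
  have hA := active_questionRound hj' hl
  have hs := shell_questionRound hk hl
  have := h.answer_eq hn hA (hq _ hA hs)
  rwa [answer_regular hA (hj.trans_eq hs.symm), answer_regular hA (hj.trans_eq hs.symm), hs,
    slot_questionRound hk hl] at this

/-- All digits of the census are out by the end of shell `j`. Reaching one shell further, it
supplies the knowledge needed to decode the questions of shell `j + 1`. -/
theorem Consistent.eq_on_shell_succ {j : ℕ} (hj : startShell R k ≤ j)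
    (hTU : ∀ m, T m = true → U m = true) (h : Consistent R r T U k n) (hn : pow4 (j + 1) ≤ n)
    (hq : ∀ q, Active R k q → shell q = j → T q = U q) :
    ∀ m < pow4 (j + 2), T m = U m := by
  have hj' : offset R k * offset R k ≤ j := (Nat.le_add_right _ _).trans hj
  have hk := lt_sqrt_of_le hj'
  have hc : count T (List.range (pow4 (j + 2))) = count U (List.range (pow4 (j + 2))) := by
    refine Nat.eq_of_testBit_eq fun i => ?_
    rcases lt_or_ge i (Nat.sqrt j) with hi | hi
    · have hl : Nat.sqrt j - 1 - i < Nat.sqrt j := by omega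
      have := h.testBit_eq hj hl ((questionRound_lt_pow4 hk hl (Nat.lt_succ_self j)).trans_le hn) hq
      rwa [show Nat.sqrt j - 1 - (Nat.sqrt j - 1 - i) = i by omega] at this
    · rw [Nat.testBit_lt_two_pow ((count_range_lt hj' T).trans_le (Nat.pow_le_pow_right two_pos hi)),
        Nat.testBit_lt_two_pow ((count_range_lt hj' U).trans_le (Nat.pow_le_pow_right two_pos hi))]
  exact fun m hm => eq_of_count_eq hTU hc m (List.mem_range.2 hm)

theorem Consistent.eq_on_shell (hr : r < R) (hTU : ∀ m, T m = true → U m = true)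
    (hun : Unfooled R r T U k) {j : ℕ} (hj : startShell R k ≤ j) (h : Consistent R r T U k n)
    (hn : pow4 j ≤ n) : ∀ q, Active R k q → shell q = j → T q = U q := by
  induction j, hj using Nat.le_induction with
  | base => exact h.eq_on_startRounds hr hTU hun hn
  | succ j hj ih =>
    intro q _ hq
    refine h.eq_on_shell_succ hj hTU hn
      (ih ((pow4_strictMono.monotone (Nat.le_succ j)).trans hn)) q ?_
    rw [← shell_lt]
    omega

theorem Consistent.eq_of_lt (hr : r < R) (hTU : ∀ m, T m = true → U m = true)
    (hun : Unfooled R r T U k) {j : ℕ} (hj : startShell R k ≤ j) (h : Consistent R r T U k n)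
    (hn : pow4 (j + 1) ≤ n) : ∀ m < pow4 (j + 2), T m = U m :=
  h.eq_on_shell_succ hj hTU hn (h.eq_on_shell hr hTU hun hj
    ((pow4_strictMono.monotone (Nat.le_succ j)).trans hn))

/-- This makes the search over stages sound. In regular shells the higher digits agree by
consistency, so a digit 1 for `T` against 0 for `U` would give the subset the larger count. -/
theorem Consistent.answer_mono (hr : r < R) (hTU : ∀ m, T m = true → U m = true)
    (hun : Unfooled R r T U k) (h : Consistent R r T U k n) (hA : Active R k n)
    (ha : answer R r T k n = true) : answer R r U k n = true := by
  rcases lt_or_ge (shell n) (startShell R k) with hs | hs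
  · by_cases hsr : shell n = offset R k * offset R k + r
    · rw [answer_initial hA hs hsr, decide_eq_true_iff] at ha ⊢
      exact ha.trans_le (count_mono hTU _)
    · rw [answer_initial_of_ne hA hs hsr] at ha
      exact absurd ha (by simp)
  · rw [answer_regular hA hs] at ha ⊢
    by_contra hb
    rw [Bool.not_eq_true] at hb
    have hj' : offset R k * offset R k ≤ shell n := (Nat.le_add_right _ _).trans hs
    refine absurd (Nat.lt_of_testBit _ hb ha fun i hi => ?_) (count_mono hTU _).not_gt
    rcases lt_or_ge i (Nat.sqrt (shell n)) with hi' | hi'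
    · have hl : Nat.sqrt (shell n) - 1 - i < Nat.sqrt (shell n) := by omega
      have hlt : questionRound (shell n) k (Nat.sqrt (shell n) - 1 - i) < n := by
        conv_rhs => rw [hA.eq_questionRound]
        exact questionRound_lt_questionRound (by omega)
      have := h.testBit_eq hs hl hlt (h.eq_on_shell hr hTU hun hs (le_shell.1 le_rfl))
      rw [show Nat.sqrt (shell n) - 1 - (Nat.sqrt (shell n) - 1 - i) = i by omega] at this
      exact this.symm
    · rw [Nat.testBit_lt_two_pow ((count_range_lt hj' T).trans_le (Nat.pow_le_pow_right two_pos hi')),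
        Nat.testBit_lt_two_pow ((count_range_lt hj' U).trans_le (Nat.pow_le_pow_right two_pos hi'))]

end Consistent

/-- In an increasing sequence of stages, at most one seed is fooled. -/
theorem unfooled_or_unfooled {R k : ℕ} {T : ℕ → ℕ → Bool} {U : ℕ → Bool}
    (hT : ∀ s t, s ≤ t → ∀ m, T s m = true → T t m = true)
    (hTU : ∀ s m, T s m = true → U m = true) {r r' : ℕ} (hr : r < R) (hr' : r' < R)
    (hne : r ≠ r') : (∀ s, Unfooled R r (T s) U k) ∨ ∀ s, Unfooled R r' (T s) U k := by
  by_contra! H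
  obtain ⟨⟨s, hs⟩, t, ht⟩ := H
  -- If stage `s` fools `r'`, it is already correct on the shell of `r`, and so are all later
  -- stages, which lie between it and `U`.
  have key : ∀ {r r' : ℕ} {s t : ℕ}, r < R → r ≠ r' → s ≤ t →
      ¬ Unfooled R r' (T s) U k → Unfooled R r (T t) U k := by
    intro r r' s t hr hne hst hs _ q hA hq
    have h1 : T s q = U q := by
      unfold Unfooled at hs
      push Not at hs
      exact hs.1 q hA (by rw [hq, startShell]; omega) (by omega)
    refine Bool.eq_iff_iff.2 ⟨hTU t q, fun hU => hT s t hst q (h1.trans hU)⟩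
  rcases le_total s t with h | h
  · exact ht (key hr' hne.symm h hs)
  · exact hs (key hr hne h ht)

/-! ### The strategies -/

/-- The number of rounds with mismatched choices that are not perfect squares. -/
def errors (x : List Bool) : ℕ :=
  count (fun q => x.getD q false && !decide (Nat.sqrt q * Nat.sqrt q = q)) (List.range x.length)

/-- The thread that is responsible for the round played on the history `x`. -/
def thread (x : List Bool) : ℕ :=
  if Nat.sqrt x.length * Nat.sqrt x.length = x.length then (slot x.length).1
  else (Nat.unpair (errors x)).1

/-- The strategy with seed `r` chooses `1` after the history `x` if `T` is taken for the complement of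
the language of the opponent. -/
def Accepts (R r : ℕ) (x : List Bool) (T : ℕ → Bool) : Prop :=
  (∀ q < x.length, Active R (thread x) q → x.getD q false = result R r T (thread x) q) ∧
    answer R r T (thread x) x.length = true

/-- The strategy with seed `r`, where `S k s` is the `s`-th stage of the enumeration of the
complement of the `k`-th language. -/
def strategy (S : ℕ → ℕ → ℕ → Bool) (R r : ℕ) : Set (List Bool) :=
  {x | ∃ s, Accepts R r x (S (thread x) s)}

theorem mem_strategy_iff {S : ℕ → ℕ → ℕ → Bool} {R r : ℕ} {x : List Bool} :
    x ∈ strategy S R r ↔ ∃ s, (∀ q < x.length, Active R (thread x) q →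
      x.getD q false = result R r (S (thread x) s) (thread x) q) ∧
    answer R r (S (thread x) s) (thread x) x.length = true := Iff.rfl

@[simp]
theorem length_history (A B : Set (List Bool)) (n : ℕ) : (history A B n).length = n := by
  induction n with
  | zero => rfl
  | succ n ih => simp [history, ih]

open Classical in
theorem getD_history (A B : Set (List Bool)) {q n : ℕ} (h : q < n) :
    (history A B n).getD q false = decide (history A B q ∈ A ∆ B) := by
  induction n with
  | zero => omega
  | succ n ih =>
    rcases Nat.lt_succ_iff_lt_or_eq.1 h with h | rfl
    · rw [history, List.getD_append _ _ _ _ (by simpa using h), ih h]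
    · rw [history, List.getD_append_right _ _ _ _ (by simp)]
      simp

open Classical in
theorem errors_history_succ (A B : Set (List Bool)) (n : ℕ) :
    errors (history A B (n + 1)) = errors (history A B n) +
      if history A B n ∈ A ∆ B ∧ ¬ Nat.sqrt n * Nat.sqrt n = n then 1 else 0 := by
  unfold errors
  rw [length_history, length_history, List.range_succ, count, List.filter_append,
    List.length_append]
  congr 1
  · refine count_congr fun q hq => ?_
    rw [List.mem_range] at hq
    rw [getD_history A B hq, getD_history A B (hq.trans (Nat.lt_succ_self n))]
  · rw [List.filter_singleton, getD_history A B (Nat.lt_succ_self n)]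
    by_cases h1 : history A B n ∈ A ∆ B <;> by_cases h2 : Nat.sqrt n * Nat.sqrt n = n <;>
      simp [h1, h2]

theorem errors_history_le (A B : Set (List Bool)) (n : ℕ) : errors (history A B n) ≤ n :=
  (count_le_length _ _).trans (by simp)

theorem exists_stage_eq {T : ℕ → ℕ → Bool} {U : ℕ → Bool}
    (hT : ∀ s t, s ≤ t → ∀ m, T s m = true → T t m = true)
    (hTU : ∀ s m, T s m = true → U m = true) (hU : ∀ m, U m = true → ∃ s, T s m = true) (N : ℕ) :
    ∃ s, ∀ m < N, T s m = U m := by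
  choose! f hf using hU
  refine ⟨(Finset.range N).sup f, fun m hm => Bool.eq_iff_iff.2 ⟨hTU _ _, fun h => ?_⟩⟩
  exact hT (f m) _ (Finset.le_sup (Finset.mem_range.2 hm)) m (hf m h)

/-! ### The play against a fixed language -/

section Play

variable {S : ℕ → ℕ → ℕ → Bool} {U : ℕ → Bool} {R r k : ℕ} {B : Set (List Bool)}

theorem mem_symmDiff_strategy_iff (hB : ∀ x : List Bool, x ∈ B ↔ U x.length = false)
    {A : Set (List Bool)} {x : List Bool} {a : Bool} (hx : x ∈ A ↔ a = true) :
    x ∈ A ∆ B ↔ xor (!U x.length) a = true := by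
  rw [Set.mem_symmDiff, hx, hB]
  cases a <;> cases U x.length <;> simp

/-- If thread `k` has answered truthfully so far, comparing a stage with the history amounts to
comparing it with `U`; rounds outside the thread do not matter. -/
theorem history_mem_strategy_iff (hB : ∀ x : List Bool, x ∈ B ↔ U x.length = false) {n : ℕ}
    (ih : ∀ q < n, Active R k q →
      (history (strategy S R r) B q ∈ strategy S R r ↔ answer R r U k q = true))
    (hk : thread (history (strategy S R r) B n) = k) :
    history (strategy S R r) B n ∈ strategy S R r ↔
      ∃ s, Consistent R r (S k s) U k n ∧ answer R r (S k s) k n = true := by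
  classical
  rw [mem_strategy_iff, hk, length_history]
  refine exists_congr fun s => and_congr_left fun _ => forall₂_congr fun q hq =>
    imp_congr_right fun hA => ?_
  rw [getD_history _ _ hq, eq_comm]
  have h := mem_symmDiff_strategy_iff hB (ih q hq hA)
  rw [length_history] at h
  rw [Bool.eq_iff_iff.2 ((Iff.of_eq (decide_eq_true_eq)).trans h)]
  rfl

variable (hS : ∀ s t, s ≤ t → ∀ m, S k s m = true → S k t m = true)
  (hSU : ∀ s m, S k s m = true → U m = true) (hU : ∀ m, U m = true → ∃ s, S k s m = true)
  (hB : ∀ x : List Bool, x ∈ B ↔ U x.length = false) (hr : r < R)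
  (hun : ∀ s, Unfooled R r (S k s) U k)

include hS hSU hU in
-- Completeness of the search: a stage that agrees with `U` up to the horizon passes every test.
theorem exists_consistent (n : ℕ) :
    ∃ s, Consistent R r (S k s) U k n ∧ answer R r (S k s) k n = answer R r U k n := by
  obtain ⟨s, hs⟩ := exists_stage_eq hS hSU hU (horizon R n)
  refine ⟨s, fun q hq _ => ?_, answer_congr hs⟩
  rw [result, result, hs q (hq.trans (lt_horizon R n)),
    answer_congr fun m hm => hs m (hm.trans_le (horizon_mono R hq.le))]

include hS hSU hU hB hr hun

theorem history_mem_strategy_of_active (n : ℕ) (hA : Active R k n) :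
    history (strategy S R r) B n ∈ strategy S R r ↔ answer R r U k n = true := by
  induction n using Nat.strong_induction_on with
  | _ n ih =>
    have hk : thread (history (strategy S R r) B n) = k := by
      rw [thread, length_history, if_pos hA.1, hA.2.1]
    rw [history_mem_strategy_iff hB ih hk]
    constructor
    · rintro ⟨s, hs, ha⟩
      exact hs.answer_mono hr (hSU s) (hun s) hA ha
    · intro ha
      obtain ⟨s, hs, hs'⟩ := exists_consistent (r := r) hS hSU hU n
      exact ⟨s, hs, hs'.trans ha⟩

theorem history_notMem_symmDiff {n : ℕ} (hn : pow4 (startShell R k + 1) ≤ n)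
    (hsq : ¬ Nat.sqrt n * Nat.sqrt n = n)
    (hk : (Nat.unpair (errors (history (strategy S R r) B n))).1 = k) :
    history (strategy S R r) B n ∉ strategy S R r ∆ B := by
  have hk' : thread (history (strategy S R r) B n) = k := by
    rw [thread, length_history, if_neg hsq, hk]
  have hna : ∀ T : ℕ → Bool, answer R r T k n = !T n := fun T => by
    rw [answer, if_neg fun hA => hsq hA.1]
  have hmem : history (strategy S R r) B n ∈ strategy S R r ↔ (!U n) = true := by
    rw [history_mem_strategy_iff hB (fun q _ =>
      history_mem_strategy_of_active hS hSU hU hB hr hun q) hk']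
    constructor
    · rintro ⟨s, hs, ha⟩
      have hj := le_shell.2 hn
      have h1 : pow4 (shell n - 1 + 1) ≤ n := by
        rw [Nat.sub_add_cancel (by omega)]; exact le_shell.1 le_rfl
      -- The census of the preceding shell is complete and covers the current one.
      have h2 := hs.eq_of_lt hr (hSU s) (hun s) (j := shell n - 1) (by omega) h1 n
        (shell_lt.1 (by omega))
      rwa [hna, h2] at ha
    · intro ha
      obtain ⟨s, hs, hs'⟩ := exists_consistent (r := r) hS hSU hU n
      exact ⟨s, hs, hs'.trans ((hna U).trans ha)⟩
  have := mem_symmDiff_strategy_iff hB hmem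
  rw [this, length_history]
  simp

/-- At the count `Nat.pair k b` it is the turn of thread `k`, and the round number, being at least
the count, is at least `b`. For `b` beyond the first census no further error occurs. -/
theorem exists_errors_le : ∃ M, ∀ n, errors (history (strategy S R r) B n) ≤ M := by
  classical
  refine ⟨Nat.pair k (pow4 (startShell R k + 1)), fun n => ?_⟩
  induction n with
  | zero => exact Nat.zero_le _
  | succ n ih =>
    rw [errors_history_succ]
    rcases ih.lt_or_eq with h | h
    · split_ifs <;> omega
    · rw [if_neg]
      · exact h.le
      · rintro ⟨h1, h2⟩
        refine history_notMem_symmDiff hS hSU hU hB hr hun ?_ h2 ?_ h1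
        · exact ((Nat.right_le_pair _ _).trans_eq h.symm).trans (errors_history_le _ _ n)
        · rw [h, Nat.unpair_pair]

end Play

/-! ### The payoff of a play with few errors -/

theorem sum_delta_le (A B : Set (List Bool)) (N : ℕ) :
    ∑ n ∈ Finset.range N, delta A B n ≤
      ((errors (history A B N) + (Nat.sqrt N + 1) : ℕ) : ℝ≥0∞) := by
  classical
  have h1 : ∀ N, ∑ n ∈ Finset.range N, delta A B n ≤ ((errors (history A B N) +
      ((Finset.range N).filter fun n => Nat.sqrt n * Nat.sqrt n = n).card : ℕ) : ℝ≥0∞) := by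
    intro N
    induction N with
    | zero => simp
    | succ N ih =>
      rw [Finset.sum_range_succ, errors_history_succ, Finset.range_add_one, Finset.filter_insert]
      refine (add_le_add_left ih _).trans ?_
      unfold delta
      by_cases h1 : history A B N ∈ A ∆ B <;> by_cases h2 : Nat.sqrt N * Nat.sqrt N = N <;>
        simp [h1, h2, add_assoc, add_comm, add_left_comm]
  refine (h1 N).trans (Nat.cast_le.2 (Nat.add_le_add_left ?_ _))
  calc _ ≤ ((Finset.range (Nat.sqrt N + 1)).image fun a => a * a).card := by
        refine Finset.card_le_card fun n hn => ?_
        rw [Finset.mem_filter, Finset.mem_range] at hn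
        exact Finset.mem_image.2 ⟨Nat.sqrt n, Finset.mem_range.2
          (Nat.lt_succ_of_le (Nat.sqrt_le_sqrt hn.1.le)), hn.2⟩
    _ ≤ Nat.sqrt N + 1 := Finset.card_image_le.trans_eq (Finset.card_range _)

theorem payoff_eq_zero_of_errors_le {A B : Set (List Bool)} {M : ℕ}
    (h : ∀ n, errors (history A B n) ≤ M) : payoff A B = 0 := by
  have hsqrt : Tendsto Nat.sqrt atTop atTop :=
    tendsto_atTop_atTop.2 fun b => ⟨b * b, fun a ha => Nat.le_sqrt.2 ha⟩
  have hlim : Tendsto (fun N : ℕ => ((M + 2 : ℕ) : ℝ≥0∞) / (Nat.sqrt N : ℝ≥0∞)) atTop (nhds 0) := by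
    have := ENNReal.Tendsto.const_div (a := ((M + 2 : ℕ) : ℝ≥0∞))
      (ENNReal.tendsto_nat_nhds_top.comp hsqrt) (Or.inr (ENNReal.natCast_ne_top _))
    simpa using this
  have hle : ∀ᶠ N : ℕ in atTop, (∑ n ∈ Finset.range N, delta A B n) / (2 * (N : ℝ≥0∞)) ≤
      ((M + 2 : ℕ) : ℝ≥0∞) / (Nat.sqrt N : ℝ≥0∞) := by
    filter_upwards [eventually_ge_atTop 1] with N hN
    have hq : 1 ≤ Nat.sqrt N := Nat.le_sqrt.2 (by simpa using hN)
    have hq0 : (Nat.sqrt N : ℝ≥0∞) ≠ 0 := by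
      rw [Nat.cast_ne_zero]; omega
    rw [ENNReal.le_div_iff_mul_le (Or.inl hq0) (Or.inl (ENNReal.natCast_ne_top _)),
      ← ENNReal.mul_div_right_comm]
    refine ENNReal.div_le_of_le_mul ((mul_le_mul_left (sum_delta_le A B N) _).trans ?_)
    have h1 : (errors (history A B N) + (Nat.sqrt N + 1)) * Nat.sqrt N ≤ (M + 2) * (2 * N) := by
      have h2 := h N
      have h3 := Nat.sqrt_le N
      have h4 : errors (history A B N) + (Nat.sqrt N + 1) ≤ (M + 2) * Nat.sqrt N := by nlinarith
      calc _ ≤ (M + 2) * Nat.sqrt N * Nat.sqrt N := Nat.mul_le_mul_right _ h4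
        _ = (M + 2) * (Nat.sqrt N * Nat.sqrt N) := mul_assoc _ _ _
        _ ≤ (M + 2) * (2 * N) := Nat.mul_le_mul_left _ (by omega)
    exact_mod_cast h1
  have hT := tendsto_of_tendsto_of_tendsto_of_le_of_le' tendsto_const_nhds hlim
    (Eventually.of_forall fun N => zero_le) hle
  rw [payoff, hT.liminf_eq, hT.limsup_eq, add_zero]

/-! ### Uniformly distributed strategies -/

theorem measurable_payoff_coe {SEq SNe : Set (Set (List Bool))} :
    Measurable fun p : SEq × SNe => payoff (p.1 : Set (List Bool)) (p.2 : Set (List Bool)) := by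
  have h : Measurable fun p : SEq × SNe => ((p.1 : Set (List Bool)), (p.2 : Set (List Bool))) :=
    (measurable_subtype_coe.comp measurable_fst).prodMk
      (measurable_subtype_coe.comp measurable_snd)
  simpa only [Function.comp_def] using Measurable.comp measurable_payoff h

theorem measurable_payoff_left {SNe : Set (Set (List Bool))} (A : Set (List Bool)) :
    Measurable fun B : SNe => payoff A (B : Set (List Bool)) := by
  have h : Measurable fun B : SNe => (A, (B : Set (List Bool))) :=
    measurable_const.prodMk measurable_subtype_coe
  simpa only [Function.comp_def] using Measurable.comp measurable_payoff h

/-- Under the uniform distribution on the `A r`, each `B` earns a positive payoff, at most 1,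
against at most one of the `R` strategies. -/
theorem minmax_le_inv {SEq SNe : Set (Set (List Bool))} {R : ℕ} (hR : R ≠ 0)
    {A : ℕ → Set (List Bool)} (hA : ∀ r, A r ∈ SEq)
    (h : ∀ B ∈ SNe, ∀ r < R, ∀ r' < R, r ≠ r' → payoff (A r) B = 0 ∨ payoff (A r') B = 0) :
    minmax SEq SNe ≤ (R : ℝ≥0∞)⁻¹ := by
  have hR0 : (R : ℝ≥0∞) ≠ 0 := Nat.cast_ne_zero.2 hR
  obtain ⟨μ, hμd⟩ : ∃ μ : Measure SEq,
    μ = ∑ r ∈ Finset.range R, (R : ℝ≥0∞)⁻¹ • Measure.dirac ⟨A r, hA r⟩ := ⟨_, rfl⟩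
  have hμ : IsProbabilityMeasure μ := ⟨by
    simp [hμd, Measure.finsetSum_apply, ENNReal.mul_inv_cancel hR0 (ENNReal.natCast_ne_top R)]⟩
  refine (iInf_le _ (⟨μ, hμ⟩ : ProbabilityMeasure SEq)).trans (iSup_le fun E => ?_)
  have hm' : Measurable fun a : SEq => ∫⁻ B, payoff (a : Set (List Bool)) (B : Set (List Bool))
      ∂(E : Measure SNe) := measurable_payoff_coe.lintegral_prod_right'
  have hsum : ∀ B : SNe, ∑ r ∈ Finset.range R, payoff (A r) (B : Set (List Bool)) ≤ 1 := by
    intro B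
    by_cases hB : ∃ r ∈ Finset.range R, payoff (A r) (B : Set (List Bool)) ≠ 0
    · obtain ⟨r, hr, hne⟩ := hB
      rw [Finset.sum_eq_single_of_mem r hr fun r' hr' hrr' => ?_]
      · exact payoff_le_one _ _
      · exact (h B B.2 r' (Finset.mem_range.1 hr') r (Finset.mem_range.1 hr) hrr').resolve_right hne
    · push Not at hB
      rw [Finset.sum_eq_zero hB]
      exact zero_le
  calc expectedPayoff (⟨μ, hμ⟩ : ProbabilityMeasure SEq) E
      = ∫⁻ a, ∫⁻ B, payoff (a : Set (List Bool)) (B : Set (List Bool)) ∂(E : Measure SNe) ∂μ := rfl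
    _ = (R : ℝ≥0∞)⁻¹ * ∫⁻ B, ∑ r ∈ Finset.range R, payoff (A r) (B : Set (List Bool))
          ∂(E : Measure SNe) := by
        rw [hμd, lintegral_finsetSum_measure, lintegral_finsetSum _ fun r _ =>
          measurable_payoff_left (A r), Finset.mul_sum]
        refine Finset.sum_congr rfl fun r _ => ?_
        rw [lintegral_smul_measure, lintegral_dirac' _ hm', smul_eq_mul]
    _ ≤ (R : ℝ≥0∞)⁻¹ * ∫⁻ _, 1 ∂(E : Measure SNe) := by
        gcongr with B
        exact hsum B
    _ = (R : ℝ≥0∞)⁻¹ := by simp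

theorem eq_zero_of_forall_le_inv {a : ℝ≥0∞} (h : ∀ R : ℕ, R ≠ 0 → a ≤ (R : ℝ≥0∞)⁻¹) : a = 0 := by
  refine le_antisymm (ge_of_tendsto ENNReal.tendsto_inv_nat_nhds_zero ?_) zero_le
  filter_upwards [eventually_ne_atTop 0] with R hR using h R hR

/-! ### The strategies are at the right level of the hierarchy -/

theorem primrec_pow4 : Primrec pow4 := by
  have h : Primrec fun m : ℕ => m * m := Primrec.nat_mul.comp .id .id
  exact Primrec.nat_mul.comp h h

theorem primrec_shell : Primrec shell := Primrec.nat_sqrt.comp Primrec.nat_sqrt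

theorem primrec_slot : Primrec slot :=
  Primrec.unpair.comp (Primrec.nat_sub.comp Primrec.nat_sqrt
    (Primrec.nat_mul.comp primrec_shell primrec_shell))

theorem primrec_offset (R : ℕ) : Primrec (offset R) :=
  Primrec.nat_add.comp (Primrec.nat_add.comp .id (.const R)) (.const 64)

theorem primrec_startShell (R : ℕ) : Primrec (startShell R) :=
  Primrec.nat_add.comp (Primrec.nat_mul.comp (primrec_offset R) (primrec_offset R)) (.const R)

theorem primrec_horizon (R : ℕ) : Primrec (horizon R) :=
  primrec_pow4.comp (Primrec.nat_add.comp (Primrec.nat_add.comp .id (.const R)) (.const 2))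

theorem primrecPred_square : PrimrecPred fun n : ℕ => Nat.sqrt n * Nat.sqrt n = n :=
  Primrec.eq.comp (Primrec.nat_mul.comp Primrec.nat_sqrt Primrec.nat_sqrt) .id

theorem primrecPred_active (R : ℕ) : PrimrecPred fun z : ℕ × ℕ => Active R z.1 z.2 :=
  (primrecPred_square.comp .snd).and <|
    (Primrec.eq.comp (Primrec.fst.comp (primrec_slot.comp .snd)) .fst).and <|
    (Primrec.nat_lt.comp (Primrec.snd.comp (primrec_slot.comp .snd))
      (Primrec.nat_sqrt.comp (primrec_shell.comp .snd))).and <|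
    Primrec.nat_le.comp (Primrec.nat_mul.comp ((primrec_offset R).comp .fst)
      ((primrec_offset R).comp .fst)) (primrec_shell.comp .snd)

theorem primrec_startRounds (R : ℕ) : Primrec (startRounds R) := by
  have h : Primrec fun z : ℕ × ℕ => startShell R z.1 * startShell R z.1 + Nat.pair z.1 z.2 :=
    Primrec.nat_add.comp (Primrec.nat_mul.comp ((primrec_startShell R).comp .fst)
      ((primrec_startShell R).comp .fst)) (Primrec₂.natPair.comp .fst .snd)
  exact Primrec.list_map (Primrec.list_range.comp (primrec_offset R))
    (Primrec.nat_mul.comp h h)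

/-- The set of natural numbers with characteristic sequence `T`. -/
def table (T : List Bool) (m : ℕ) : Bool := T.getD m false

theorem primrec_table : Primrec₂ table := Primrec.list_getD false

theorem primrec_count_table : Primrec₂ fun (T : List Bool) (l : List ℕ) => count (table T) l := by
  have h : PrimrecRel fun (m : ℕ) (T : List Bool) => table T m = true :=
    Primrec.eq.comp (primrec_table.comp .snd .fst) (.const true)
  refine (Primrec.list_length.comp (h.listFilter.comp (α := List Bool × List ℕ) .snd .fst)).of_eq
    fun z => ?_
  simp [count]

theorem primrec_testBit : Primrec₂ Nat.testBit := by
  have hpow : Primrec₂ fun a b : ℕ => a ^ b := Primrec₂.unpaired'.1 Nat.Primrec.pow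
  have h : PrimrecPred fun z : ℕ × ℕ => z.1 / 2 ^ z.2 % 2 = 1 :=
    Primrec.eq.comp (Primrec.nat_mod.comp (Primrec.nat_div.comp .fst
      (hpow.comp (.const 2) .snd)) (.const 2)) (.const 1)
  exact h.decide.of_eq fun z => (Nat.testBit_eq_decide_div_mod_eq).symm

theorem primrec_answer_table (R r : ℕ) :
    Primrec fun z : List Bool × ℕ × ℕ => answer R r (table z.1) z.2.1 z.2.2 := by
  have hk : Primrec fun z : List Bool × ℕ × ℕ => z.2.1 := .comp .fst .snd
  have hn : Primrec fun z : List Bool × ℕ × ℕ => z.2.2 := .comp .snd .snd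
  have hs := primrec_shell.comp hn
  have hb := Primrec.snd.comp (primrec_slot.comp hn)
  have ho := (primrec_offset R).comp hk
  have hA : PrimrecPred fun z : List Bool × ℕ × ℕ => Active R z.2.1 z.2.2 :=
    (primrecPred_active R).comp .snd
  have h1 : PrimrecPred fun z : List Bool × ℕ × ℕ =>
      (slot z.2.2).2 < count (table z.1) (startRounds R z.2.1) :=
    Primrec.nat_lt.comp hb (primrec_count_table.comp .fst ((primrec_startRounds R).comp hk))
  have h2 : Primrec fun z : List Bool × ℕ × ℕ =>
      (count (table z.1) (List.range (pow4 (shell z.2.2 + 2)))).testBit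
        (Nat.sqrt (shell z.2.2) - 1 - (slot z.2.2).2) :=
    primrec_testBit.comp
      (primrec_count_table.comp .fst (Primrec.list_range.comp (primrec_pow4.comp
        (Primrec.nat_add.comp hs (.const 2)))))
      (Primrec.nat_sub.comp (Primrec.nat_sub.comp (Primrec.nat_sqrt.comp hs) (.const 1)) hb)
  exact Primrec.ite hA
    (Primrec.ite (Primrec.nat_lt.comp hs ((primrec_startShell R).comp hk))
      (Primrec.ite (Primrec.eq.comp hs (Primrec.nat_add.comp (Primrec.nat_mul.comp ho ho)
        (.const r))) h1.decide (.const false)) h2)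
    (Primrec.not.comp (primrec_table.comp .fst hn))

theorem primrec_result_table (R r : ℕ) :
    Primrec fun z : List Bool × ℕ × ℕ => result R r (table z.1) z.2.1 z.2.2 :=
  (Primrec.dom_bool₂ Bool.xor).comp
    (Primrec.not.comp (primrec_table.comp .fst (.comp .snd .snd))) (primrec_answer_table R r)

theorem primrec_errors : Primrec errors := by
  have h : PrimrecRel fun (q : ℕ) (x : List Bool) =>
      table x q = true ∧ ¬ Nat.sqrt q * Nat.sqrt q = q :=
    PrimrecPred.and (Primrec.eq.comp (primrec_table.comp .snd .fst) (.const true))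
      (primrecPred_square.comp .fst).not
  refine (Primrec.list_length.comp (h.listFilter.comp
    (Primrec.list_range.comp Primrec.list_length) .id)).of_eq fun x => ?_
  rw [errors, count]
  congr 2
  funext q
  simp [table]

theorem primrec_thread : Primrec thread :=
  Primrec.ite (primrecPred_square.comp Primrec.list_length)
    (Primrec.fst.comp (primrec_slot.comp Primrec.list_length))
    (Primrec.fst.comp (Primrec.unpair.comp primrec_errors))

theorem accepts_congr {R r : ℕ} {x : List Bool} {T U : ℕ → Bool}
    (h : ∀ m < horizon R x.length, T m = U m) : Accepts R r x T ↔ Accepts R r x U := by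
  rw [Accepts, Accepts, answer_congr h]
  refine and_congr_left fun _ => forall₂_congr fun q hq => imp_congr_right fun _ => ?_
  rw [result, result, h q (hq.trans (lt_horizon R _)),
    answer_congr fun m hm => h m (hm.trans_le (horizon_mono R hq.le))]

theorem computablePred_accepts_table (R r : ℕ) :
    ComputablePred fun z : List Bool × List Bool => Accepts R r z.1 (table z.2) := by
  have hk : Primrec fun z : List Bool × List Bool => thread z.1 := primrec_thread.comp .fst
  have hk' : Primrec fun z : (List Bool × List Bool) × ℕ => thread z.1.1 := hk.comp .fst
  have h1 : PrimrecPred fun z : List Bool × List Bool =>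
      answer R r (table z.2) (thread z.1) z.1.length = true :=
    Primrec.eq.comp ((primrec_answer_table R r).comp
      (Primrec.snd.pair (hk.pair (Primrec.list_length.comp .fst)))) (.const true)
  have h2 : PrimrecPred fun z : (List Bool × List Bool) × ℕ =>
      ¬ Active R (thread z.1.1) z.2 ∨
        z.1.1.getD z.2 false = result R r (table z.1.2) (thread z.1.1) z.2 :=
    ((primrecPred_active R).comp (hk'.pair .snd)).not.or
      (Primrec.eq.comp ((Primrec.list_getD false).comp (Primrec.fst.comp .fst) .snd)
        ((primrec_result_table R r).comp ((Primrec.snd.comp .fst).pair (hk'.pair .snd))))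
  have h3 := computablePred_forall_lt (f := fun z : List Bool × List Bool => z.1.length)
    (Primrec.list_length.comp .fst).to_comp h2.computablePred
  refine (computablePred_and h3 h1.computablePred).of_eq fun z => ?_
  simp only [Accepts, imp_iff_not_or]

open Classical in
/-- The `s`-th stage of the enumeration of the `k`-th `Σ⁰ᵢ₊₁` set. -/
noncomputable def univStage (i k s m : ℕ) : Bool := decide (∃ y < s, univMatrix i (k, m, y))

/-- With a finite table in place of the stage, acceptance is decidable; the quantifier complexity is
confined to the agreement of table and stage. -/
theorem mem_strategy_univStage_iff {i R r : ℕ} {x : List Bool} :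
    x ∈ strategy (univStage i) R r ↔ ∃ T : List Bool, ∃ s,
      (∀ m < horizon R x.length, table T m = univStage i (thread x) s m) ∧
        Accepts R r x (table T) := by
  rw [mem_strategy_iff]
  constructor
  · rintro ⟨s, hs⟩
    have hT : ∀ m < horizon R x.length,
        table ((List.range (horizon R x.length)).map (univStage i (thread x) s)) m =
          univStage i (thread x) s m := fun m hm => by simp [table, hm]
    exact ⟨_, s, hT, (accepts_congr hT).2 hs⟩
  · rintro ⟨T, s, hT, h⟩
    exact ⟨s, (accepts_congr hT).1 h⟩

/-- The matrix is `Π⁰ᵢ`. An entry 1 needs an existential quantifier over it; an entry 0 only a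
quantifier bounded by `s` over its `Σ⁰ᵢ` negation. -/
theorem isSigma_table_eq_univStage (i : ℕ) :
    IsSigma (i + 1) fun z : List Bool × ℕ × ℕ × ℕ =>
      table z.1 z.2.2.2 = univStage i z.2.1 z.2.2.1 z.2.2.2 := by
  have hT : Primrec fun z : List Bool × ℕ × ℕ × ℕ => table z.1 z.2.2.2 :=
    primrec_table.comp .fst (.comp .snd (.comp .snd .snd))
  have h1 : PrimrecPred fun z : List Bool × ℕ × ℕ × ℕ => table z.1 z.2.2.2 = true :=
    Primrec.eq.comp hT (.const true)
  have hs : Primrec fun z : List Bool × ℕ × ℕ × ℕ => z.2.2.1 := .comp .fst (.comp .snd .snd)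
  have hc : Primrec fun z : (List Bool × ℕ × ℕ × ℕ) × ℕ => (z.1.2.1, z.1.2.2.2, z.2) :=
    Primrec.pair (.comp .fst (.comp .snd .fst))
      (.pair (.comp .snd (.comp .snd (.comp .snd .fst))) .snd)
  have hV := isSigma_comp (p := fun z => ¬ univMatrix i z)
    (f := fun z : (List Bool × ℕ × ℕ × ℕ) × ℕ => (z.1.2.1, z.1.2.2.2, z.2)) hc.to_comp
    (isSigma_not_univMatrix i)
  have hlt : PrimrecPred fun z : (List Bool × ℕ × ℕ × ℕ) × ℕ => z.2 < z.1.2.2.1 :=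
    Primrec.nat_lt.comp .snd (hs.comp .fst)
  have hV' : IsSigma (i + 1) fun z : (List Bool × ℕ × ℕ × ℕ) × ℕ =>
      univMatrix i (z.1.2.1, z.1.2.2.2, z.2) := isSigma_succ_of_not hV
  have h2 : IsSigma (i + 1) fun z : List Bool × ℕ × ℕ × ℕ =>
      ∃ y, y < z.2.2.1 ∧ univMatrix i (z.2.1, z.2.2.2, y) :=
    isSigma_exists_nat (isSigma_and (isSigma_of_computablePred hlt.computablePred) hV')
  have h3 : IsSigma (i + 1) fun z : List Bool × ℕ × ℕ × ℕ =>
      ∀ y < z.2.2.1, ¬ univMatrix i (z.2.1, z.2.2.2, y) :=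
    isSigma_forall_lt hs.to_comp (isSigma_succ hV)
  refine isSigma_of_iff (isSigma_or
    (isSigma_and (isSigma_of_computablePred h1.computablePred) h2)
    (isSigma_and (isSigma_of_computablePred h1.not.computablePred) h3)) fun z => ?_
  by_cases hz : ∃ y < z.2.2.1, univMatrix i (z.2.1, z.2.2.2, y)
  · have hz' : ¬ ∀ y < z.2.2.1, ¬ univMatrix i (z.2.1, z.2.2.2, y) := by
      push Not
      exact hz
    simp only [univStage, hz, hz', and_true, and_false, or_false, decide_true]
  · have hz' : (∀ y < z.2.2.1, ¬ univMatrix i (z.2.1, z.2.2.2, y)) ↔ True := by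
      push Not at hz
      exact iff_true_intro hz
    simp only [univStage, hz, hz', and_true, and_false, false_or, decide_false,
      Bool.not_eq_true]

theorem strategy_mem_sigmaLang (i R r : ℕ) : strategy (univStage i) R r ∈ SigmaLang (i + 1) := by
  have hc : Primrec fun z : ((List Bool × List Bool) × ℕ) × ℕ =>
      (z.1.1.2, thread z.1.1.1, z.1.2, z.2) :=
    Primrec.pair (.comp .snd (.comp .fst .fst)) (Primrec.pair
      (primrec_thread.comp (.comp .fst (.comp .fst .fst))) (Primrec.pair (.comp .snd .fst) .snd))
  have h1 := isSigma_comp (p := fun z : List Bool × ℕ × ℕ × ℕ =>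
      table z.1 z.2.2.2 = univStage i z.2.1 z.2.2.1 z.2.2.2)
    (f := fun z : ((List Bool × List Bool) × ℕ) × ℕ => (z.1.1.2, thread z.1.1.1, z.1.2, z.2))
    hc.to_comp (isSigma_table_eq_univStage i)
  have h2 : IsSigma (i + 1) fun z : (List Bool × List Bool) × ℕ =>
      ∀ m < horizon R z.1.1.length, table z.1.2 m = univStage i (thread z.1.1) z.2 m :=
    isSigma_forall_lt ((primrec_horizon R).comp
      (Primrec.list_length.comp (Primrec.fst.comp .fst))).to_comp h1
  have h3 := isSigma_comp (p := fun z : List Bool × List Bool => Accepts R r z.1 (table z.2))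
    (f := fun z : (List Bool × List Bool) × ℕ => z.1) .fst
    (isSigma_of_computablePred (i := i + 1) (computablePred_accepts_table R r))
  have h4 : IsSigma (i + 1) fun z : List Bool × List Bool => ∃ s,
      (∀ m < horizon R z.1.length, table z.2 m = univStage i (thread z.1) s m) ∧
        Accepts R r z.1 (table z.2) := isSigma_exists_nat (isSigma_and h2 h3)
  exact isSigma_of_iff (isSigma_exists h4) fun x => mem_strategy_univStage_iff.symm

theorem payoff_strategy_eq_zero {i R : ℕ} {w : ℕ → List Bool} (hw : Computable w)
    {B : Set (List Bool)} (hB : B ∈ NA w '' PiLang (i + 1)) {r r' : ℕ} (hr : r < R) (hr' : r' < R)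
    (hne : r ≠ r') : payoff (strategy (univStage i) R r) B = 0 ∨
      payoff (strategy (univStage i) R r') B = 0 := by
  classical
  obtain ⟨L, hL, rfl⟩ := hB
  have hL' : IsSigma (i + 1) fun u : List Bool => u ∈ Lᶜ := hL
  obtain ⟨k, hk⟩ := exists_univMatrix_index (isSigma_comp hw hL')
  -- `U` is the `Σ⁰ᵢ₊₁` complement of `L` pulled back along `w`; the stages of index `k` exhaust it.
  let U : ℕ → Bool := fun m => decide (w m ∈ Lᶜ)
  have hS : ∀ s t, s ≤ t → ∀ m, univStage i k s m = true → univStage i k t m = true := by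
    intro s t hst m h
    rw [univStage, decide_eq_true_iff] at h ⊢
    obtain ⟨y, hy, h⟩ := h
    exact ⟨y, hy.trans_le hst, h⟩
  have hSU : ∀ s m, univStage i k s m = true → U m = true := by
    intro s m h
    rw [univStage, decide_eq_true_iff] at h
    obtain ⟨y, -, h⟩ := h
    exact decide_eq_true ((hk m).2 ⟨y, h⟩)
  have hU : ∀ m, U m = true → ∃ s, univStage i k s m = true := by
    intro m h
    obtain ⟨y, hy⟩ := (hk m).1 (of_decide_eq_true h)
    exact ⟨y + 1, decide_eq_true ⟨y, Nat.lt_succ_self y, hy⟩⟩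
  have hB : ∀ x : List Bool, x ∈ NA w L ↔ U x.length = false := by
    intro x
    simp [NA, U]
  have key : ∀ {r}, r < R → (∀ s, Unfooled R r (univStage i k s) U k) →
      payoff (strategy (univStage i) R r) (NA w L) = 0 := by
    intro r hr hun
    obtain ⟨M, hM⟩ := exists_errors_le hS hSU hU hB hr hun
    exact payoff_eq_zero_of_errors_le hM
  exact (unfooled_or_unfooled hS hSU hr hr' hne).imp (key hr) (key hr')

end IMP

/-- For every `i > 0`, `Π⁰ᵢ` is learnable by `Σ⁰ᵢ`, whichever computable enumeration `w` of the
binary words is used to define nonadaptive languages. -/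
theorem mainTheorem6 (w : ℕ → List Bool) (hw : Computable w) (hw' : Function.Surjective w)
    (i : ℕ) (hi : 0 < i) :
    IMP.LearnableBy w (IMP.PiLang i) (IMP.SigmaLang i) := by
  obtain ⟨i, rfl⟩ := Nat.exists_eq_add_of_lt hi
  rw [zero_add]
  exact IMP.eq_zero_of_forall_le_inv fun R hR =>
    IMP.minmax_le_inv hR (IMP.strategy_mem_sigmaLang i R) fun B hB r hr r' hr' hne =>
      IMP.payoff_strategy_eq_zero hw hB hr hr' hne
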